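/- **Setting.** Consider the discrete-time plant/actuator cascade $x_1(k+1)=A_1x_1(k)+B_1v(k)$, $x_2(k+1)=A_2x_2(k)+B_2u(k)$, $v(k)=Cx_2(k)$, with $x_1\in\mathbb R^{n_1}$, $x_2\in\mathbb R^{n_2}$, $v\in\mathbb R^q$, and $u(k)\in U\subset\mathbb R^p$, and a reference model $x_f(k+1)=A_fx_f(k)+B_fv_{des}(k)$, $x_f\in\mathbb R^{n_2}$. Put $x_1^{aug}=(x_1,x_f)$, $\tilde x=x_2-x_f$, $\tilde v=C\tilde x$; then $$x_1^{aug}(k+1)=A_1^{aug}x_1^{aug}(k)+B_1^{aug}\tilde v(k)+B_f^{aug}v_{des}(k),\qquad \tilde x(k+1)=A_2\tilde x(k)+(A_2-A_f)x_f(k)+B_2u(k)-B_fv_{des}(k), \tag{1}$$ where $A_1^{aug}=\begin{bmatrix}A_1&B_1C\\0&A_f\end{bmatrix}$, $B_1^{aug}=\begin{bmatrix}B_1\\0\end{bmatrix}$, $B_f^{aug}=\begin{bmatrix}0\\B_f\end{bmatrix}$. Norms are Euclidean, with the induced operator norms for matrices. **Terminal ingredients.** Let $K_1,K_{21},K_{22}$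 be gain matrices, $G_1\subset\mathbb R^{n_1+n_2}$ and $G_2\subset\mathbb R^{n_2}$ bounded convex neighbourhoods of $0$, and $\lambda_1,\lambda_2\in[0,1)$, such that $(G_1,G_2)$ is $\lambda$-contractive under the terminal laws: if $x_1^{aug}(k)\in G_1$, $\tilde x(k)\in G_2$, $v_{des}(k)=-K_1x_1^{aug}(k)$ and $u(k)=K_{21}v_{des}(k)-K_{22}x_2(k)$, then $u(k)\in U$, $x_1^{aug}(k+1)\in\lambda_1G_1$ and $\tilde x(k+1)\in\lambda_2G_2$. **Design constants.** Let $N\ge1$ be the horizon, $0<\beta<1$, and let $\Delta_1,\Delta_2$ be such that every point within distance $\Delta_i$ of $\lambda_iG_i$ lies in $G_i$. Let $\epsilon_{\tilde v},\delta_{v},\delta_{u}>0$ and $\epsilon_{f}$ satisfy $$\epsilon_{\tilde v}\sum_{j=0}^{N-1}\|(A_1^{aug})^jB_1^{aug}\|\le\Delta_1,\quad \epsilon_f\le\Delta_2,\quad \delta_u\|C\|\sum_{j=0}^{N-1}\|A_2^jB_2\|\le\epsilon_{\tilde v}-\|C\|\epsilon_f,\quad \delta_v\sum_{j=0}^{N-1}\|A_f^jB_f\|\le\epsilon_f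 .$$ Let further $N_1^*,N_2^*\in\mathbb N$, and let $g_1,g_2$ be arbitrary real-valued stage costs. **Controller.** If $x_1^{aug}(k)\in G_1$ and $\tilde x(k)\in G_2$, then the terminal laws above are applied. Otherwise model predictive control is active. Write $a(i|k)$ for the value of $a$ at step $i$ predicted at time $k$; predictions obey (1) and start from the current state. * *Outer optimization.* Minimize $\sum_{i=k}^{k+N-1}g_1(x_1^{aug}(i|k),v_{des}(i|k))$ over $v_{des}(k|k),\dots,v_{des}(k+N-1|k)$, where the prediction of $x_1^{aug}(\cdot|k)$ uses the stored $\tilde v(\cdot|k-1)$, subject to $x_1^{aug}(k+N-1|k)\in G_1$, $x_1^{aug}(k+N|k)\in\lambda_1G_1$, and $\|v_{des}(k+i|k)-v_{des}(k+i|k-1)\|\le\delta_v\beta^{\min(k,N_1^*)}$ for $i=0,\dots,N-2$. Only those $v_{des}$-trajectories are allowed for which the following inner optimization is feasible. * *Inner optimization.* Given $v_{des}(\cdot|k)$ and the resulting $x_f(\cdot|k)$, minimize $\sum_{i=k}^{k+N-1}g_2(\tilde x(i|k),u(i|k))$ over $u(k|k),\dots,u(k+N-1|k)$, subject to $\tilde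 x(k+N|k)\in\lambda_2G_2$, $u(k+i|k)\in U$ for $i=0,\dots,N-1$, and $\|u(k+i|k)-u(k+i|k-1)\|\le\delta_u\beta^{\min(k,N_2^*)}$ for $i=0,\dots,N-2$. Where a minimum is not attained, any admissible trajectory may be used. The inputs $v_{des}(k|k)$ and $u(k|k)$ are applied, and $\tilde v(\cdot|k)=C\tilde x(\cdot|k)$ is stored. At $k=0$ the rate-like constraints are dropped; instead an initial guess $\tilde v(0|-1),\dots,\tilde v(N-1|-1)$ is given, and any trajectories may be used that satisfy the remaining constraints and $\|\tilde v(i|0)-\tilde v(i|-1)\|\le\epsilon_{\tilde v}$ for $i=0,\dots,N-1$. Let $X\subset\mathbb R^{n_1+2n_2}$ be the set of those initial states $(x_1^{aug}(0),\tilde x(0))$ for which such a guess and such trajectories exist. When model predictive control is active at $k=0$, the guess is one for which such trajectories exist. **Theorem (Asymptotic stability).** There is $\bar N$, depending only on the system, the terminal ingredients and the design constants $N,\beta,\epsilon_{\tilde v},\delta_v,\delta_u,\Delta_1,\Delta_2,\epsilon_f$ (not on the stage costs or the initial state), such that for all $N_1^*,N_2^*\ge\bar N$ and all stage costs $g_1,g_2$,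 the origin $x_1^{aug}=0$, $\tilde x=0$ of the closed loop is asymptotically stable with region of attraction $X$. That is: 1. for every $\eta>0$ there is $\rho>0$ such that every closed-loop trajectory that starts with norm less than $\rho$ has norm less than $\eta$ at all times; 2. $X$ is a neighbourhood of the origin; 3. $X$ is exactly the set of initial states from which the controller can be started, the optimizations are feasible at every step at which they are carried out, along every closed-loop trajectory, and every closed-loop trajectory converges to the origin. -/

import Mathlib

open scoped Pointwise Topology Matrix.Norms.L2Operator

noncomputable section

namespace HierMPC

/-- Vectors of `ℝⁿ` with the Euclidean norm. -/
abbrev Vec (n : ℕ) : Type := EuclideanSpace ℝ (Fin n)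

/-- Augmented outer loop states `(x₁, x_f)`, with the Euclidean norm of `ℝ^(n₁+n₂)`. -/
abbrev AugVec (n₁ n₂ : ℕ) : Type := EuclideanSpace ℝ (Fin n₁ ⊕ Fin n₂)

/-- Plant `x₁⁺ = A₁ x₁ + B₁ v`, actuator `x₂⁺ = A₂ x₂ + B₂ u`, `v = C x₂` with saturation set `U`,
and reference model `x_f⁺ = A_f x_f + B_f v_des`, `v_des^f = C x_f`. -/
structure Plant (n₁ n₂ q p : ℕ) where
  A₁ : Matrix (Fin n₁) (Fin n₁) ℝ
  B₁ : Matrix (Fin n₁) (Fin q) ℝ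
  A₂ : Matrix (Fin n₂) (Fin n₂) ℝ
  B₂ : Matrix (Fin n₂) (Fin p) ℝ
  C : Matrix (Fin q) (Fin n₂) ℝ
  Af : Matrix (Fin n₂) (Fin n₂) ℝ
  Bf : Matrix (Fin n₂) (Fin q) ℝ
  U : Set (Vec p)

/-- Terminal ingredients: gains, terminal sets and contraction rates. -/
structure Terminal (n₁ n₂ q p : ℕ) where
  K₁ : Matrix (Fin q) (Fin n₁ ⊕ Fin n₂) ℝ
  K₂₁ : Matrix (Fin p) (Fin q) ℝ
  K₂₂ : Matrix (Fin p) (Fin n₂) ℝ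
  G₁ : Set (AugVec n₁ n₂)
  G₂ : Set (Vec n₂)
  lam₁ : ℝ
  lam₂ : ℝ

/-- Horizon `N`, initial tolerance `ε` on the predicted `ṽ`, rate-like bounds `δv` (on `v_des`) and
`δu` (on `u`), and decay factor `β`. -/
structure Rates where
  N : ℕ
  ε : ℝ
  δv : ℝ
  δu : ℝ
  β : ℝ

/-- The steps `N₁*`, `N₂*` at which the rate-like bounds stop decreasing, and the stage costs. -/
structure Tuning (n₁ n₂ q p : ℕ) where
  N₁ : ℕ
  N₂ : ℕ
  g₁ : AugVec n₁ n₂ → Vec q → ℝ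
  g₂ : Vec n₂ → Vec p → ℝ

section

variable {n₁ n₂ q p : ℕ}

/-- The reference model component `x_f` of an augmented state. -/
def xf (z : AugVec n₁ n₂) : Vec n₂ := WithLp.toLp 2 (fun i => z (Sum.inr i))

namespace Plant

variable (P : Plant n₁ n₂ q p)

def A₁aug : Matrix (Fin n₁ ⊕ Fin n₂) (Fin n₁ ⊕ Fin n₂) ℝ :=
  Matrix.fromBlocks P.A₁ (P.B₁ * P.C) 0 P.Af

def B₁aug : Matrix (Fin n₁ ⊕ Fin n₂) (Fin q) ℝ := Matrix.fromRows P.B₁ 0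

def Bfaug : Matrix (Fin n₁ ⊕ Fin n₂) (Fin q) ℝ := Matrix.fromRows 0 P.Bf

/-- `C` acting on `x̃`, i.e. `ṽ = C x̃`. -/
def out (xt : Vec n₂) : Vec q := Matrix.toEuclideanLin P.C xt

/-- Augmented outer loop dynamics `x₁ᵃᵘᵍ⁺ = A₁ᵃᵘᵍ x₁ᵃᵘᵍ + B₁ᵃᵘᵍ ṽ + B_fᵃᵘᵍ v_des`. -/
def outerNext (z : AugVec n₁ n₂) (vt vdes : Vec q) : AugVec n₁ n₂ :=
  Matrix.toEuclideanLin P.A₁aug z + Matrix.toEuclideanLin P.B₁aug vt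
    + Matrix.toEuclideanLin P.Bfaug vdes

/-- Error dynamics `x̃⁺ = A₂ x̃ + (A₂ - A_f) x_f + B₂ u - B_f v_des`. -/
def innerNext (xt ξ : Vec n₂) (vdes : Vec q) (u : Vec p) : Vec n₂ :=
  Matrix.toEuclideanLin P.A₂ xt + Matrix.toEuclideanLin (P.A₂ - P.Af) ξ
    + Matrix.toEuclideanLin P.B₂ u - Matrix.toEuclideanLin P.Bf vdes

/-- Outer loop prediction: entry `i` is `x₁ᵃᵘᵍ(k+i|k)`, when `z = x₁ᵃᵘᵍ(k)`, `w i = ṽ(k+i|k-1)` and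
`v i = v_des(k+i|k)`. -/
def outerPred (z : AugVec n₁ n₂) (w v : ℕ → Vec q) : ℕ → AugVec n₁ n₂
  | 0 => z
  | i + 1 => P.outerNext (outerPred z w v i) (w i) (v i)

/-- Inner loop prediction: entry `i` is `x̃(k+i|k)`, when `xt = x̃(k)`, `ξ i = x_f(k+i|k)`,
`v i = v_des(k+i|k)` and `u i = u(k+i|k)`. -/
def innerPred (xt : Vec n₂) (ξ : ℕ → Vec n₂) (v : ℕ → Vec q) (u : ℕ → Vec p) : ℕ → Vec n₂
  | 0 => xt
  | i + 1 => P.innerNext (innerPred xt ξ v u i) (ξ i) (v i) (u i)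

end Plant

namespace Terminal

variable (T : Terminal n₁ n₂ q p)

/-- Outer terminal law `v_des = -K₁ x₁ᵃᵘᵍ`. -/
def vTerm (z : AugVec n₁ n₂) : Vec q := -Matrix.toEuclideanLin T.K₁ z

/-- Inner terminal law `u_t = K₂₁ v_des - K₂₂ x₂`, with `v_des = -K₁ x₁ᵃᵘᵍ` and `x₂ = x̃ + x_f`. -/
def uTerm (z : AugVec n₁ n₂) (xt : Vec n₂) : Vec p :=
  Matrix.toEuclideanLin T.K₂₁ (T.vTerm z) - Matrix.toEuclideanLin T.K₂₂ (xt + xf z)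

/-- `G₁`, `G₂` are bounded convex neighbourhoods of the origin that are `λ`-contractive under the
terminal control laws, which respect the input constraint there. -/
structure IsContractive (P : Plant n₁ n₂ q p) : Prop where
  convex₁ : Convex ℝ T.G₁
  convex₂ : Convex ℝ T.G₂
  bounded₁ : Bornology.IsBounded T.G₁
  bounded₂ : Bornology.IsBounded T.G₂
  nhds₁ : T.G₁ ∈ 𝓝 0
  nhds₂ : T.G₂ ∈ 𝓝 0
  lam₁_nonneg : 0 ≤ T.lam₁
  lam₁_lt : T.lam₁ < 1
  lam₂_nonneg : 0 ≤ T.lam₂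
  lam₂_lt : T.lam₂ < 1
  input : ∀ z ∈ T.G₁, ∀ xt ∈ T.G₂, T.uTerm z xt ∈ P.U
  outer : ∀ z ∈ T.G₁, ∀ xt ∈ T.G₂, P.outerNext z (P.out xt) (T.vTerm z) ∈ T.lam₁ • T.G₁
  inner : ∀ z ∈ T.G₁, ∀ xt ∈ T.G₂,
    P.innerNext xt (xf z) (T.vTerm z) (T.uTerm z xt) ∈ T.lam₂ • T.G₂

end Terminal

/-- The choice of the tolerances: `Δ₁`, `Δ₂` are margins of `λ₁G₁` in `G₁` and of `λ₂G₂` in `G₂`,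
and `ε`, `εf`, `δv`, `δu` bound the changes of `ṽ`, `x_f`, `v_des`, `u` between consecutive
predictions, in operator norms induced by the Euclidean norms. -/
structure IsRateDesign (P : Plant n₁ n₂ q p) (T : Terminal n₁ n₂ q p) (R : Rates)
    (Δ₁ Δ₂ εf : ℝ) : Prop where
  N_pos : 0 < R.N
  ε_pos : 0 < R.ε
  δv_pos : 0 < R.δv
  δu_pos : 0 < R.δu
  β_pos : 0 < R.β
  β_lt : R.β < 1
  margin₁ : ∀ y ∈ T.lam₁ • T.G₁, ∀ z, ‖z - y‖ ≤ Δ₁ → z ∈ T.G₁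
  margin₂ : ∀ y ∈ T.lam₂ • T.G₂, ∀ x, ‖x - y‖ ≤ Δ₂ → x ∈ T.G₂
  ε_le : R.ε * ∑ j ∈ Finset.range R.N, ‖P.A₁aug ^ j * P.B₁aug‖ ≤ Δ₁
  εf_le : εf ≤ Δ₂
  δu_le : R.δu * (‖P.C‖ * ∑ j ∈ Finset.range R.N, ‖P.A₂ ^ j * P.B₂‖) ≤ R.ε - ‖P.C‖ * εf
  δv_le : R.δv * ∑ j ∈ Finset.range R.N, ‖P.Af ^ j * P.Bf‖ ≤ εf

/-- Terminal constraints of the outer optimization: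
`x₁ᵃᵘᵍ(k+N-1|k) ∈ G₁` and `x₁ᵃᵘᵍ(k+N|k) ∈ λ₁G₁`. -/
def OuterConstraints (P : Plant n₁ n₂ q p) (T : Terminal n₁ n₂ q p) (N : ℕ)
    (z : AugVec n₁ n₂) (w v : ℕ → Vec q) : Prop :=
  P.outerPred z w v (N - 1) ∈ T.G₁ ∧ P.outerPred z w v N ∈ T.lam₁ • T.G₁

/-- The predicted inner loop trajectory `x̃(k+i|k)`, driven by the trajectory `x_f(k+i|k)` which the
outer loop has computed. -/
def innerTraj (P : Plant n₁ n₂ q p) (z : AugVec n₁ n₂) (xt : Vec n₂) (w v : ℕ → Vec q)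
    (u : ℕ → Vec p) : ℕ → Vec n₂ :=
  P.innerPred xt (fun i => xf (P.outerPred z w v i)) v u

/-- Terminal and saturation constraints of the inner optimization:
`x̃(k+N|k) ∈ λ₂G₂` and `u(k+i|k) ∈ U` for `i = 0, …, N-1`. -/
def InnerConstraints (P : Plant n₁ n₂ q p) (T : Terminal n₁ n₂ q p) (N : ℕ)
    (z : AugVec n₁ n₂) (xt : Vec n₂) (w v : ℕ → Vec q) (u : ℕ → Vec p) : Prop :=
  innerTraj P z xt w v u N ∈ T.lam₂ • T.G₂ ∧ ∀ i < N, u i ∈ P.U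

/-- Requirement at time `0`: `‖ṽ(i|0) - ṽ(i|-1)‖ ≤ ε` for `i = 0, …, N-1`. -/
def InitialTolerance (P : Plant n₁ n₂ q p) (R : Rates)
    (z : AugVec n₁ n₂) (xt : Vec n₂) (w v : ℕ → Vec q) (u : ℕ → Vec p) : Prop :=
  ∀ i < R.N, ‖P.out (innerTraj P z xt w v u i) - w i‖ ≤ R.ε

/-- The rate-like constraint at time `k` with constant `δ` and saturation step `Nst`:
`‖a(k+i|k) - a(k+i|k-1)‖ ≤ δ β^min(k,Nst)` for `i = 0, …, N-2`, where `a i = a(k+i|k)` and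
`prev i = a(k-1+i|k-1)`. -/
def RateConstraint {m : ℕ} (N : ℕ) (δ β : ℝ) (Nst k : ℕ) (prev a : ℕ → Vec m) : Prop :=
  ∀ i, i + 1 < N → ‖a i - prev (i + 1)‖ ≤ δ * β ^ min k Nst

/-- The initial feasibility set `X`: for some initial guess `w i = ṽ(i|-1)` there are control
trajectories `v`, `u` at time `0` that satisfy all constraints other than the rate-like ones and
keep `ṽ(i|0)` within `ε` of the guess. -/
def feasibleSet (P : Plant n₁ n₂ q p) (T : Terminal n₁ n₂ q p) (R : Rates) :
    Set (AugVec n₁ n₂ × Vec n₂) :=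
  {x | ∃ (w v : ℕ → Vec q) (u : ℕ → Vec p), OuterConstraints P T R.N x.1 w v ∧
    InnerConstraints P T R.N x.1 x.2 w v u ∧ InitialTolerance P R x.1 x.2 w v u}

/-- State of the closed loop at time `k`: the states `z = x₁ᵃᵘᵍ(k)`, `xt = x̃(k)` and the
trajectories stored by the controller, `w i = ṽ(k+i|k-1)`, `v i = v_des(k-1+i|k-1)`,
`u i = u(k-1+i|k-1)`. Only the entries `i < N` matter. -/
structure LoopState (n₁ n₂ q p : ℕ) where
  z : AugVec n₁ n₂
  xt : Vec n₂
  w : ℕ → Vec q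
  v : ℕ → Vec q
  u : ℕ → Vec p

/-- The pair `(x₁ᵃᵘᵍ, x̃)`. -/
def LoopState.phys (s : LoopState n₁ n₂ q p) : AugVec n₁ n₂ × Vec n₂ := (s.z, s.xt)

/-- Control trajectories `u` admissible for the inner optimization at time `k`, given the outer
trajectory `v`. -/
def innerFeasible (P : Plant n₁ n₂ q p) (T : Terminal n₁ n₂ q p) (R : Rates)
    (S : Tuning n₁ n₂ q p) (k : ℕ) (s : LoopState n₁ n₂ q p) (v : ℕ → Vec q) :
    Set (ℕ → Vec p) :=
  {u | InnerConstraints P T R.N s.z s.xt s.w v u ∧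
    (k = 0 → InitialTolerance P R s.z s.xt s.w v u) ∧
    (k ≠ 0 → RateConstraint R.N R.δu R.β S.N₂ k s.u u)}

/-- Trajectories `v_des` admissible for the outer optimization at time `k`: the outer constraints
hold, and the resulting inner optimization is feasible. -/
def outerFeasible (P : Plant n₁ n₂ q p) (T : Terminal n₁ n₂ q p) (R : Rates)
    (S : Tuning n₁ n₂ q p) (k : ℕ) (s : LoopState n₁ n₂ q p) : Set (ℕ → Vec q) :=
  {v | OuterConstraints P T R.N s.z s.w v ∧
    (k ≠ 0 → RateConstraint R.N R.δv R.β S.N₁ k s.v v) ∧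
    (innerFeasible P T R S k s v).Nonempty}

/-- Outer cost `J₁`. -/
def outerCost (P : Plant n₁ n₂ q p) (R : Rates) (S : Tuning n₁ n₂ q p)
    (s : LoopState n₁ n₂ q p) (v : ℕ → Vec q) : ℝ :=
  ∑ i ∈ Finset.range R.N, S.g₁ (P.outerPred s.z s.w v i) (v i)

/-- Inner cost `J₂`. -/
def innerCost (P : Plant n₁ n₂ q p) (R : Rates) (S : Tuning n₁ n₂ q p)
    (s : LoopState n₁ n₂ q p) (v : ℕ → Vec q) (u : ℕ → Vec p) : ℝ :=
  ∑ i ∈ Finset.range R.N, S.g₂ (innerTraj P s.z s.xt s.w v u i) (u i)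

/-- `a` is a possible result of the optimization of `J` over `F` at time `k`: a minimizer if there
is one, and, where the minimum is not attained, any element of `F`. At time `0` any
admissible trajectory may be chosen. -/
def IsChoice {α : Type*} (k : ℕ) (F : Set α) (J : α → ℝ) (a : α) : Prop :=
  a ∈ F ∧ (k ≠ 0 → (∃ b ∈ F, IsMinOn J F b) → IsMinOn J F a)

/-- Both loops are in their terminal sets. -/
def InTerminal (T : Terminal n₁ n₂ q p) (s : LoopState n₁ n₂ q p) : Prop :=
  s.z ∈ T.G₁ ∧ s.xt ∈ T.G₂

/-- The possible successors at time `k+1` of the closed loop state `s` at time `k`. In the terminal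
mode the stored trajectories are left open: the terminal sets are invariant, so they are not
used any more. The set is empty exactly if model predictive control is active and infeasible. -/
def successors (P : Plant n₁ n₂ q p) (T : Terminal n₁ n₂ q p) (R : Rates)
    (S : Tuning n₁ n₂ q p) (k : ℕ) (s : LoopState n₁ n₂ q p) : Set (LoopState n₁ n₂ q p) :=
  {s' |
    (InTerminal T s ∧
      s'.z = P.outerNext s.z (P.out s.xt) (T.vTerm s.z) ∧
      s'.xt = P.innerNext s.xt (xf s.z) (T.vTerm s.z) (T.uTerm s.z s.xt)) ∨
    (¬ InTerminal T s ∧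
      IsChoice k (outerFeasible P T R S k s) (outerCost P R S s) s'.v ∧
      IsChoice k (innerFeasible P T R S k s s'.v) (innerCost P R S s s'.v) s'.u ∧
      s'.z = P.outerNext s.z (P.out s.xt) (s'.v 0) ∧
      s'.xt = P.innerNext s.xt (xf s.z) (s'.v 0) (s'.u 0) ∧
      ∀ i < R.N, s'.w i = P.out (innerTraj P s.z s.xt s.w s'.v s'.u (i + 1)))}

/-- `σ 0, …, σ M` is the beginning of a closed loop run from `x`. The controller can be started in
`σ 0`, i.e. `σ 0` has a successor. -/
def IsRunUpTo (P : Plant n₁ n₂ q p) (T : Terminal n₁ n₂ q p) (R : Rates)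
    (S : Tuning n₁ n₂ q p) (x : AugVec n₁ n₂ × Vec n₂) (M : ℕ)
    (σ : ℕ → LoopState n₁ n₂ q p) : Prop :=
  (σ 0).phys = x ∧ (successors P T R S 0 (σ 0)).Nonempty ∧
    ∀ k < M, σ (k + 1) ∈ successors P T R S k (σ k)

/-- `σ` is an infinite closed loop run from `x`. -/
def IsRun (P : Plant n₁ n₂ q p) (T : Terminal n₁ n₂ q p) (R : Rates)
    (S : Tuning n₁ n₂ q p) (x : AugVec n₁ n₂ × Vec n₂)
    (σ : ℕ → LoopState n₁ n₂ q p) : Prop :=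
  ∀ M, IsRunUpTo P T R S x M σ

/-- The region of attraction of the origin: the controller can be started in `x`, no run from `x`
ever gets stuck (the optimizations remain feasible), and along every run
`(x₁ᵃᵘᵍ(k), x̃(k)) → 0`. -/
def regionOfAttraction (P : Plant n₁ n₂ q p) (T : Terminal n₁ n₂ q p) (R : Rates)
    (S : Tuning n₁ n₂ q p) : Set (AugVec n₁ n₂ × Vec n₂) :=
  {x | (∃ σ, IsRunUpTo P T R S x 0 σ) ∧
    (∀ M σ, IsRunUpTo P T R S x M σ → (successors P T R S M (σ M)).Nonempty) ∧
    ∀ σ, IsRun P T R S x σ → Filter.Tendsto (fun k => (σ k).phys) Filter.atTop (𝓝 0)}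

/-- The origin is stable in the sense of Lyapunov and attracts a neighbourhood of itself. -/
def IsAsymptoticallyStable (P : Plant n₁ n₂ q p) (T : Terminal n₁ n₂ q p) (R : Rates)
    (S : Tuning n₁ n₂ q p) : Prop :=
  (∀ η > 0, ∃ ρ > 0, ∀ x, ‖x‖ < ρ → ∀ σ, IsRun P T R S x σ → ∀ k, ‖(σ k).phys‖ < η) ∧
    regionOfAttraction P T R S ∈ 𝓝 0

end

end HierMPC

end

namespace HierMPC

open scoped Pointwise Topology Matrix.Norms.L2Operator

/-! ### Perturbation bounds for linear recursions. -/

section LinearRecursion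

/-! In terminal mode, linearity of the dynamics and of the terminal laws turns contractivity of (G₁,
G₂) into contractivity of every scaled pair (tG₁, tG₂). This yields geometric decay once both
terminal sets are reached, and Lyapunov stability, since small initial states start inside a small
scaled pair (`mem_smul_of_run`).

Under predictive control, everything rests on comparing predictions made at consecutive times. Since
x_f is driven by v_des alone and x₂ = x̃ + x_f by u alone, the rate constraints bound the change of
x̃, and the change of ṽ by ε times the decay factor (`IsTransition.norm_out_sub_le`). The outer
prediction also errs by using the previous ṽ; over the horizon this costs at most Δ₁. So shifting
the old trajectories keeps x̃ and moves the end of the outer prediction from λ₁G₁ to a point still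
in G₁, from where the terminal laws add one feasible step (`IsTransition.outerFeasible_nonempty`).

If predictive control stayed active forever, the rate bounds would fall to multiples of βⁿ. The
state at time k + N would differ from its prediction at time k, a point of λᵢGᵢ, by at most N times
a drift proportional to βⁿ. For large n this is below the margin of λᵢGᵢ in Gᵢ, so the terminal sets
are reached after all (`exists_inTerminal`). Only feasibility of the chosen inputs is used, so the
stage costs play no role. -/

theorem norm_toEuclideanLin_le {ι κ : Type*} [Fintype ι] [Fintype κ] [DecidableEq κ]
    (A : Matrix ι κ ℝ) (x : EuclideanSpace ℝ κ) : ‖Matrix.toEuclideanLin A x‖ ≤ ‖A‖ * ‖x‖ :=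
  Matrix.l2_opNorm_mulVec A x

variable {r r' : ℕ} {ι : Type*} [Fintype ι] [DecidableEq ι]

/-- Variation of constants for `e⁺ = A e + f` with zero initial value. -/
theorem eq_sum_of_recursion (A : Matrix ι ι ℝ) (e f : ℕ → EuclideanSpace ℝ ι) (h0 : e 0 = 0)
    (n : ℕ) (h : ∀ i < n, e (i + 1) = Matrix.toEuclideanLin A (e i) + f i) :
    e n = ∑ j ∈ Finset.range n, Matrix.toEuclideanLin (A ^ j) (f (n - 1 - j)) := by
  induction n with
  | zero => simpa using h0
  | succ n ih =>
    rw [h n n.lt_succ_self, ih fun i hi => h i (hi.trans n.lt_succ_self), map_sum,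
      Finset.sum_range_succ']
    congr 1
    · refine Finset.sum_congr rfl fun j _ => ?_
      rw [pow_succ', Matrix.toLpLin_mul_same, LinearMap.comp_apply,
        show n + 1 - 1 - (j + 1) = n - 1 - j by omega]
    · simp

/-- The sums run over the whole horizon `M` so that all prediction steps share the bound occurring
in the design inequalities. -/
theorem norm_le_of_recursion (A : Matrix ι ι ℝ) (B : Matrix ι (Fin r) ℝ)
    (B' : Matrix ι (Fin r') ℝ) (e : ℕ → EuclideanSpace ℝ ι) (d : ℕ → Vec r) (d' : ℕ → Vec r')
    {D D' : ℝ} {n M : ℕ} (hnM : n ≤ M) (hD0 : 0 ≤ D) (hD0' : 0 ≤ D') (h0 : e 0 = 0)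
    (h : ∀ i < n, e (i + 1) = Matrix.toEuclideanLin A (e i)
      + (Matrix.toEuclideanLin B (d i) + Matrix.toEuclideanLin B' (d' i)))
    (hd : ∀ i < n, ‖d i‖ ≤ D) (hd' : ∀ i < n, ‖d' i‖ ≤ D') :
    ‖e n‖ ≤ D * ∑ j ∈ Finset.range M, ‖A ^ j * B‖ + D' * ∑ j ∈ Finset.range M, ‖A ^ j * B'‖ := by
  have hsum : ‖e n‖ ≤ ∑ j ∈ Finset.range n, (D * ‖A ^ j * B‖ + D' * ‖A ^ j * B'‖) := by
    rw [eq_sum_of_recursion A e _ h0 n h]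
    refine norm_sum_le_of_le _ fun j hj => ?_
    have hj' : n - 1 - j < n := by have := Finset.mem_range.1 hj; omega
    rw [map_add, ← LinearMap.comp_apply, ← LinearMap.comp_apply, ← Matrix.toLpLin_mul_same,
      ← Matrix.toLpLin_mul_same]
    refine (norm_add_le _ _).trans (add_le_add ?_ ?_)
    · rw [mul_comm]
      exact (norm_toEuclideanLin_le _ _).trans
        (mul_le_mul_of_nonneg_left (hd _ hj') (norm_nonneg _))
    · rw [mul_comm]
      exact (norm_toEuclideanLin_le _ _).trans
        (mul_le_mul_of_nonneg_left (hd' _ hj') (norm_nonneg _))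
  refine hsum.trans ?_
  rw [Finset.mul_sum, Finset.mul_sum, ← Finset.sum_add_distrib]
  exact Finset.sum_le_sum_of_subset_of_nonneg (Finset.range_mono hnM) fun j _ _ => by positivity

theorem norm_le_of_recursion_single (A : Matrix ι ι ℝ) (B : Matrix ι (Fin r) ℝ)
    (e : ℕ → EuclideanSpace ℝ ι) (d : ℕ → Vec r) {D : ℝ} {n M : ℕ} (hnM : n ≤ M) (hD0 : 0 ≤ D)
    (h0 : e 0 = 0)
    (h : ∀ i < n, e (i + 1) = Matrix.toEuclideanLin A (e i) + Matrix.toEuclideanLin B (d i))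
    (hd : ∀ i < n, ‖d i‖ ≤ D) : ‖e n‖ ≤ D * ∑ j ∈ Finset.range M, ‖A ^ j * B‖ := by
  simpa using norm_le_of_recursion A B (0 : Matrix ι (Fin r) ℝ) e d (fun _ => 0) hnM hD0 le_rfl h0
    (fun i hi => by simpa using h i hi) hd (by simp)

end LinearRecursion

/-! ### Scaled convex sets and their margins. -/

section ContractedSets

variable {E : Type*} [NormedAddCommGroup E] [NormedSpace ℝ E] {G : Set E}

theorem smul_subset_smul_of_le (hG : Convex ℝ G) (h0 : (0 : E) ∈ G) {a b : ℝ} (ha : 0 ≤ a)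
    (hab : a ≤ b) (hb : 0 < b) : a • G ⊆ b • G := by
  rintro _ ⟨g, hg, rfl⟩
  refine ⟨(a / b) • g, hG.smul_mem_of_zero_mem h0 hg ⟨by positivity, (div_le_one hb).2 hab⟩, ?_⟩
  simp only [smul_smul]
  rw [mul_div_cancel₀ _ hb.ne']

theorem smul_subset_self (hG : Convex ℝ G) (h0 : (0 : E) ∈ G) {a : ℝ} (ha : 0 ≤ a)
    (ha1 : a ≤ 1) : a • G ⊆ G := by
  simpa using smul_subset_smul_of_le hG h0 ha ha1 one_pos

/-- A point near a • g is the convex combination of g, with weight a, and a small vector of G, with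
weight 1 - a. -/
theorem exists_margin (hG : Convex ℝ G) (h0 : G ∈ 𝓝 (0 : E)) {a : ℝ} (ha : 0 ≤ a) (ha1 : a < 1) :
    ∃ δ > 0, ∀ y ∈ a • G, ∀ z, ‖z - y‖ ≤ δ → z ∈ G := by
  obtain ⟨r, hr, hrG⟩ := Metric.nhds_basis_closedBall.mem_iff.1 h0
  have h1 : 0 < 1 - a := by linarith
  refine ⟨(1 - a) * r, by positivity, ?_⟩
  rintro _ ⟨g, hg, rfl⟩ z hz
  have hmem : (1 - a)⁻¹ • (z - a • g) ∈ G := hrG (by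
    rw [mem_closedBall_zero_iff, norm_smul, norm_inv, Real.norm_of_nonneg h1.le,
      inv_mul_le_iff₀ h1]
    exact hz)
  have := hG hg hmem ha h1.le (by ring)
  rwa [smul_inv_smul₀ h1.ne', add_sub_cancel] at this

end ContractedSets

variable {n₁ n₂ q p : ℕ} {P : Plant n₁ n₂ q p} {T : Terminal n₁ n₂ q p} {R : Rates}
  {S : Tuning n₁ n₂ q p} {Δ₁ Δ₂ εf : ℝ}

/-! ### Homogeneity of the dynamics and causality of the predictions. -/

section Dynamics

theorem xf_smul (t : ℝ) (z : AugVec n₁ n₂) : xf (t • z) = t • xf z := rfl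

theorem xf_outerNext (z : AugVec n₁ n₂) (a b : Vec q) :
    xf (P.outerNext z a b)
      = Matrix.toEuclideanLin P.Af (xf z) + Matrix.toEuclideanLin P.Bf b := by
  ext i
  simp [xf, Plant.outerNext, Plant.A₁aug, Plant.B₁aug, Plant.Bfaug, Matrix.toLpLin_apply,
    Matrix.mulVec, dotProduct, Fintype.sum_sum_type]

/-- The reference model cancels from x̃ + x_f = x₂, leaving the actuator dynamics. -/
theorem innerNext_add (xt ξ : Vec n₂) (b : Vec q) (u : Vec p) :
    P.innerNext xt ξ b u + (Matrix.toEuclideanLin P.Af ξ + Matrix.toEuclideanLin P.Bf b)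
      = Matrix.toEuclideanLin P.A₂ (xt + ξ) + Matrix.toEuclideanLin P.B₂ u := by
  simp only [Plant.innerNext, map_add, map_sub, LinearMap.sub_apply]
  abel

theorem outerNext_smul (t : ℝ) (z : AugVec n₁ n₂) (a b : Vec q) :
    P.outerNext (t • z) (t • a) (t • b) = t • P.outerNext z a b := by
  simp only [Plant.outerNext, map_smul, smul_add]

theorem innerNext_smul (t : ℝ) (xt ξ : Vec n₂) (b : Vec q) (u : Vec p) :
    P.innerNext (t • xt) (t • ξ) (t • b) (t • u) = t • P.innerNext xt ξ b u := by
  simp only [Plant.innerNext, map_smul, smul_add, smul_sub]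

theorem out_smul (t : ℝ) (xt : Vec n₂) : P.out (t • xt) = t • P.out xt := map_smul _ _ _

theorem out_sub (x y : Vec n₂) : P.out (x - y) = P.out x - P.out y := map_sub _ _ _

theorem vTerm_smul (t : ℝ) (z : AugVec n₁ n₂) : T.vTerm (t • z) = t • T.vTerm z := by
  simp only [Terminal.vTerm, map_smul, smul_neg]

theorem uTerm_smul (t : ℝ) (z : AugVec n₁ n₂) (xt : Vec n₂) :
    T.uTerm (t • z) (t • xt) = t • T.uTerm z xt := by
  simp only [Terminal.uTerm, vTerm_smul, xf_smul, ← smul_add, map_smul, smul_sub]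

theorem outerPred_congr (z : AugVec n₁ n₂) (w : ℕ → Vec q) {v v' : ℕ → Vec q} {n : ℕ}
    (h : ∀ i < n, v i = v' i) : P.outerPred z w v n = P.outerPred z w v' n := by
  induction n with
  | zero => rfl
  | succ n ih =>
    simp only [Plant.outerPred, ih fun i hi => h i (hi.trans n.lt_succ_self), h n n.lt_succ_self]

theorem innerTraj_zero (z : AugVec n₁ n₂) (xt : Vec n₂) (w v : ℕ → Vec q) (u : ℕ → Vec p) :
    innerTraj P z xt w v u 0 = xt := rfl

theorem innerTraj_succ (z : AugVec n₁ n₂) (xt : Vec n₂) (w v : ℕ → Vec q) (u : ℕ → Vec p)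
    (i : ℕ) : innerTraj P z xt w v u (i + 1) = P.innerNext (innerTraj P z xt w v u i)
      (xf (P.outerPred z w v i)) (v i) (u i) := rfl

theorem innerTraj_congr (z : AugVec n₁ n₂) (xt : Vec n₂) (w v : ℕ → Vec q) {u u' : ℕ → Vec p}
    {n : ℕ} (h : ∀ i < n, u i = u' i) :
    innerTraj P z xt w v u n = innerTraj P z xt w v u' n := by
  induction n with
  | zero => rfl
  | succ n ih =>
    rw [innerTraj_succ, innerTraj_succ, ih fun i hi => h i (hi.trans n.lt_succ_self),
      h n n.lt_succ_self]

end Dynamics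

/-! ### Terminal mode: invariance, geometric decay, Lyapunov stability. -/

section TerminalMode

theorem Terminal.IsContractive.lam₁_smul_subset (hT : T.IsContractive P) :
    T.lam₁ • T.G₁ ⊆ T.G₁ :=
  smul_subset_self hT.convex₁ (mem_of_mem_nhds hT.nhds₁) hT.lam₁_nonneg hT.lam₁_lt.le

theorem Terminal.IsContractive.lam₂_smul_subset (hT : T.IsContractive P) :
    T.lam₂ • T.G₂ ⊆ T.G₂ :=
  smul_subset_self hT.convex₂ (mem_of_mem_nhds hT.nhds₂) hT.lam₂_nonneg hT.lam₂_lt.le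

/-- A common positive contraction rate of both loops. -/
noncomputable def Terminal.rate (T : Terminal n₁ n₂ q p) : ℝ := max (max T.lam₁ T.lam₂) (1 / 2)

theorem Terminal.rate_pos : 0 < T.rate := lt_max_of_lt_right (by norm_num)

theorem Terminal.IsContractive.rate_lt (hT : T.IsContractive P) : T.rate < 1 :=
  max_lt (max_lt hT.lam₁_lt hT.lam₂_lt) (by norm_num)

/-- The closed outer loop is homogeneous, so the contraction on the unscaled sets carries over to
any factor t; convexity then enlarges λ₁ to the common rate. -/
theorem Terminal.IsContractive.outer_smul (hT : T.IsContractive P) {t : ℝ}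
    {z : AugVec n₁ n₂} {xt : Vec n₂} (hz : z ∈ t • T.G₁) (hx : xt ∈ t • T.G₂) :
    P.outerNext z (P.out xt) (T.vTerm z) ∈ (T.rate * t) • T.G₁ := by
  obtain ⟨a, ha, rfl⟩ := hz
  obtain ⟨b, hb, rfl⟩ := hx
  simp only [out_smul, vTerm_smul, outerNext_smul]
  rw [mul_comm, mul_smul]
  exact Set.smul_mem_smul_set (smul_subset_smul_of_le hT.convex₁ (mem_of_mem_nhds hT.nhds₁)
    hT.lam₁_nonneg ((le_max_left _ _).trans (le_max_left _ _)) T.rate_pos (hT.outer a ha b hb))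

theorem Terminal.IsContractive.inner_smul (hT : T.IsContractive P) {t : ℝ}
    {z : AugVec n₁ n₂} {xt : Vec n₂} (hz : z ∈ t • T.G₁) (hx : xt ∈ t • T.G₂) :
    P.innerNext xt (xf z) (T.vTerm z) (T.uTerm z xt) ∈ (T.rate * t) • T.G₂ := by
  obtain ⟨a, ha, rfl⟩ := hz
  obtain ⟨b, hb, rfl⟩ := hx
  simp only [vTerm_smul, uTerm_smul, xf_smul, innerNext_smul]
  rw [mul_comm, mul_smul]
  exact Set.smul_mem_smul_set (smul_subset_smul_of_le hT.convex₂ (mem_of_mem_nhds hT.nhds₂)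
    hT.lam₂_nonneg ((le_max_right _ _).trans (le_max_left _ _)) T.rate_pos (hT.inner a ha b hb))

theorem successors_of_inTerminal {k : ℕ} {s s' : LoopState n₁ n₂ q p} (hs : InTerminal T s)
    (h : s' ∈ successors P T R S k s) :
    s'.z = P.outerNext s.z (P.out s.xt) (T.vTerm s.z) ∧
      s'.xt = P.innerNext s.xt (xf s.z) (T.vTerm s.z) (T.uTerm s.z s.xt) := by
  rcases h with h | h
  · exact h.2
  · exact absurd hs h.1

theorem inTerminal_succ (hT : T.IsContractive P) {k : ℕ} {s s' : LoopState n₁ n₂ q p}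
    (hs : InTerminal T s) (h : s' ∈ successors P T R S k s) : InTerminal T s' := by
  obtain ⟨hz, hx⟩ := successors_of_inTerminal hs h
  exact ⟨hz ▸ hT.lam₁_smul_subset (hT.outer _ hs.1 _ hs.2),
    hx ▸ hT.lam₂_smul_subset (hT.inner _ hs.1 _ hs.2)⟩

theorem successors_nonempty_of_inTerminal {k : ℕ} {s : LoopState n₁ n₂ q p}
    (hs : InTerminal T s) : (successors P T R S k s).Nonempty :=
  ⟨⟨_, _, s.w, s.v, s.u⟩, Or.inl ⟨hs, rfl, rfl⟩⟩

theorem mem_smul_of_run (hT : T.IsContractive P) {σ : ℕ → LoopState n₁ n₂ q p}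
    (hσ : ∀ k, σ (k + 1) ∈ successors P T R S k (σ k)) {k : ℕ} {t : ℝ} (ht : 0 ≤ t) (ht1 : t ≤ 1)
    (hz : (σ k).z ∈ t • T.G₁) (hx : (σ k).xt ∈ t • T.G₂) (j : ℕ) :
    (σ (k + j)).z ∈ (T.rate ^ j * t) • T.G₁ ∧ (σ (k + j)).xt ∈ (T.rate ^ j * t) • T.G₂ := by
  induction j with
  | zero => simpa using ⟨hz, hx⟩
  | succ j ih =>
    have hp := pow_nonneg (T.rate_pos).le j
    have h0 : 0 ≤ T.rate ^ j * t := mul_nonneg hp ht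
    have h1 : T.rate ^ j * t ≤ 1 :=
      mul_le_one₀ (pow_le_one₀ (T.rate_pos).le hT.rate_lt.le) ht ht1
    have hs : InTerminal T (σ (k + j)) :=
      ⟨smul_subset_self hT.convex₁ (mem_of_mem_nhds hT.nhds₁) h0 h1 ih.1,
        smul_subset_self hT.convex₂ (mem_of_mem_nhds hT.nhds₂) h0 h1 ih.2⟩
    obtain ⟨hz', hx'⟩ := successors_of_inTerminal hs (hσ (k + j))
    rw [← add_assoc, hz', hx', pow_succ', mul_assoc]
    exact ⟨hT.outer_smul ih.1 ih.2, hT.inner_smul ih.1 ih.2⟩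

theorem exists_norm_bound (hT : T.IsContractive P) :
    ∃ B > 0, ∀ t : ℝ, 0 ≤ t → ∀ s : LoopState n₁ n₂ q p, s.z ∈ t • T.G₁ → s.xt ∈ t • T.G₂ →
      ‖s.phys‖ ≤ t * B := by
  obtain ⟨B₁, hB₁, h₁⟩ := hT.bounded₁.exists_pos_norm_le
  obtain ⟨B₂, hB₂, h₂⟩ := hT.bounded₂.exists_pos_norm_le
  refine ⟨max B₁ B₂, lt_max_of_lt_left hB₁, ?_⟩
  rintro t ht ⟨_, _, w, v, u⟩ ⟨a, ha, rfl⟩ ⟨b, hb, rfl⟩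
  simp only [LoopState.phys, Prod.norm_mk, norm_smul, Real.norm_of_nonneg ht]
  exact max_le (mul_le_mul_of_nonneg_left ((h₁ a ha).trans (le_max_left _ _)) ht)
    (mul_le_mul_of_nonneg_left ((h₂ b hb).trans (le_max_right _ _)) ht)

theorem tendsto_of_inTerminal (hT : T.IsContractive P) {σ : ℕ → LoopState n₁ n₂ q p}
    (hσ : ∀ k, σ (k + 1) ∈ successors P T R S k (σ k)) {k : ℕ} (hk : InTerminal T (σ k)) :
    Filter.Tendsto (fun k => (σ k).phys) Filter.atTop (𝓝 0) := by
  obtain ⟨B, -, hB⟩ := exists_norm_bound hT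
  rw [← Filter.tendsto_add_atTop_iff_nat k]
  have hlim : Filter.Tendsto (fun j => T.rate ^ j * 1 * B) Filter.atTop (𝓝 0) := by
    simpa using (tendsto_pow_atTop_nhds_zero_of_lt_one (T.rate_pos).le hT.rate_lt).mul_const B
  refine squeeze_zero_norm (fun j => ?_) hlim
  obtain ⟨hz, hx⟩ := mem_smul_of_run hT hσ zero_le_one le_rfl
    (by simpa using hk.1) (by simpa using hk.2) j
  rw [add_comm j k]
  exact hB _ (mul_nonneg (pow_nonneg (T.rate_pos).le j) zero_le_one) _ hz hx

theorem lyapunov_stable (hT : T.IsContractive P) {η : ℝ} (hη : 0 < η) :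
    ∃ ρ > 0, ∀ x, ‖x‖ < ρ → ∀ σ, IsRun P T R S x σ → ∀ k, ‖(σ k).phys‖ < η := by
  obtain ⟨B, hB0, hB⟩ := exists_norm_bound hT
  -- The cap 1 puts the scaled pair inside the terminal sets, so the terminal laws apply from the
  -- start; the factor 2 makes the final inequality strict.
  set t : ℝ := min 1 (η / (2 * B))
  have ht : 0 < t := lt_min one_pos (by positivity)
  have hnhds : (t • T.G₁) ×ˢ (t • T.G₂) ∈ 𝓝 (0 : AugVec n₁ n₂ × Vec n₂) :=
    prod_mem_nhds (by simpa using smul_mem_nhds_smul₀ ht.ne' hT.nhds₁)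
      (by simpa using smul_mem_nhds_smul₀ ht.ne' hT.nhds₂)
  obtain ⟨ρ, hρ, hsub⟩ := Metric.nhds_basis_ball.mem_iff.1 hnhds
  refine ⟨ρ, hρ, fun x hx σ hσ k => ?_⟩
  have h0 : (σ 0).phys ∈ (t • T.G₁) ×ˢ (t • T.G₂) :=
    hsub (mem_ball_zero_iff.2 ((hσ 0).1 ▸ hx))
  obtain ⟨hz, hxt⟩ := mem_smul_of_run hT (fun k => (hσ (k + 1)).2.2 k k.lt_succ_self) ht.le
    (min_le_left _ _) h0.1 h0.2 k
  rw [zero_add] at hz hxt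
  have hpow := pow_le_one₀ (n := k) (T.rate_pos).le hT.rate_lt.le
  have hpow0 := pow_nonneg (T.rate_pos).le k
  calc ‖(σ k).phys‖ ≤ T.rate ^ k * t * B := hB _ (by positivity) _ hz hxt
    _ ≤ t * B := by nlinarith [mul_pos ht hB0]
    _ ≤ η / (2 * B) * B := mul_le_mul_of_nonneg_right (min_le_right _ _) hB0.le
    _ = η / 2 := by field_simp
    _ < η := by linarith

/-- The closed loop under the terminal laws. -/
noncomputable def terminalLoop (P : Plant n₁ n₂ q p) (T : Terminal n₁ n₂ q p)
    (x : AugVec n₁ n₂ × Vec n₂) : ℕ → AugVec n₁ n₂ × Vec n₂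
  | 0 => x
  | i + 1 =>
    let y := terminalLoop P T x i
    (P.outerNext y.1 (P.out y.2) (T.vTerm y.1),
      P.innerNext y.2 (xf y.1) (T.vTerm y.1) (T.uTerm y.1 y.2))

/-- Take as initial guess the very ṽ produced by the terminal laws: the outer prediction is then
exact and the tolerance is met with error zero. -/
theorem terminal_subset_feasibleSet (hT : T.IsContractive P)
    (hR : IsRateDesign P T R Δ₁ Δ₂ εf) : T.G₁ ×ˢ T.G₂ ⊆ feasibleSet P T R := by
  rintro x ⟨hx₁, hx₂⟩
  set y := terminalLoop P T x
  have hy : ∀ i, (y i).1 ∈ T.G₁ ∧ (y i).2 ∈ T.G₂ := by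
    intro i
    induction i with
    | zero => exact ⟨hx₁, hx₂⟩
    | succ i ih => exact ⟨hT.lam₁_smul_subset (hT.outer _ ih.1 _ ih.2),
        hT.lam₂_smul_subset (hT.inner _ ih.1 _ ih.2)⟩
  set w := fun i => P.out (y i).2
  set v := fun i => T.vTerm (y i).1
  set u := fun i => T.uTerm (y i).1 (y i).2
  have hz : ∀ i, P.outerPred x.1 w v i = (y i).1 := by
    intro i
    induction i with
    | zero => rfl
    | succ i ih => rw [Plant.outerPred, ih]; rfl
  have hxt : ∀ i, innerTraj P x.1 x.2 w v u i = (y i).2 := by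
    intro i
    induction i with
    | zero => rfl
    | succ i ih => rw [innerTraj_succ, ih, hz]; rfl
  obtain ⟨n, hn⟩ := Nat.exists_eq_succ_of_ne_zero hR.N_pos.ne'
  refine ⟨w, v, u, ⟨?_, ?_⟩, ⟨?_, ?_⟩, ?_⟩
  · rw [hz]; exact (hy _).1
  · rw [hz, hn]; exact hT.outer _ (hy n).1 _ (hy n).2
  · rw [hxt, hn]; exact hT.inner _ (hy n).1 _ (hy n).2
  · exact fun i _ => hT.input _ (hy i).1 _ (hy i).2
  · intro i _
    rw [hxt, sub_self, norm_zero]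
    exact hR.ε_pos.le

end TerminalMode

/-! ### Comparison of consecutive predictions and the shifted trajectories. -/

section Prediction

/-- `s'` results from `s` by applying the predicted trajectories `s'.v`, `s'.u`. -/
structure IsTransition (P : Plant n₁ n₂ q p) (N : ℕ) (s s' : LoopState n₁ n₂ q p) : Prop where
  z_eq : s'.z = P.outerNext s.z (P.out s.xt) (s'.v 0)
  xt_eq : s'.xt = P.innerNext s.xt (xf s.z) (s'.v 0) (s'.u 0)
  w_eq : ∀ i < N, s'.w i = P.out (innerTraj P s.z s.xt s.w s'.v s'.u (i + 1))

variable {N : ℕ} {s s' : LoopState n₁ n₂ q p} {v' : ℕ → Vec q} {u' : ℕ → Vec p}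

theorem IsTransition.norm_outerPred_sub_le (h : IsTransition P N s s') {E D : ℝ} (hE0 : 0 ≤ E)
    (hD0 : 0 ≤ D)
    (hE : ∀ i < N, ‖P.out (innerTraj P s.z s.xt s.w s'.v s'.u i) - s.w i‖ ≤ E)
    (hD : ∀ i, i + 1 < N → ‖v' i - s'.v (i + 1)‖ ≤ D) {i : ℕ} (hi : i < N) :
    ‖P.outerPred s'.z s'.w v' i - P.outerPred s.z s.w s'.v (i + 1)‖
      ≤ E * ∑ j ∈ Finset.range N, ‖P.A₁aug ^ j * P.B₁aug‖
        + D * ∑ j ∈ Finset.range N, ‖P.A₁aug ^ j * P.Bfaug‖ := by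
  -- The error is indexed from time k, where both predictions share the state; at time k + 1 it is
  -- already nonzero, because the plant saw the true ṽ(k) and not the stored one. The applied v_des
  -- is the predicted one, hence the default 0 in `d'`.
  let e : ℕ → AugVec n₁ n₂ := fun j => Nat.casesOn j 0 fun i =>
    P.outerPred s'.z s'.w v' i - P.outerPred s.z s.w s'.v (i + 1)
  let d' : ℕ → Vec q := fun j => Nat.casesOn j 0 fun i => v' i - s'.v (i + 1)
  refine norm_le_of_recursion P.A₁aug P.B₁aug P.Bfaug e
    (fun i => P.out (innerTraj P s.z s.xt s.w s'.v s'.u i) - s.w i) d' (n := i + 1) hi hE0 hD0 rfl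
    (fun j hj => ?_) (fun j hj => hE j (by omega)) (fun j hj => ?_)
  · cases j with
    | zero =>
      rw [show e 0 = 0 from rfl, show d' 0 = 0 from rfl, map_zero, map_zero, zero_add, add_zero]
      change P.outerPred s'.z s'.w v' 0 - P.outerPred s.z s.w s'.v (0 + 1) = _
      simp only [Plant.outerPred, h.z_eq, innerTraj_zero, Plant.outerNext, map_sub]
      abel
    | succ j =>
      simp only [e, d', Plant.outerPred, h.w_eq j (by omega), Plant.outerNext, map_sub, map_add]
      abel
  · cases j with
    | zero => simpa [d'] using hD0
    | succ j => exact hD j (by omega)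

theorem IsTransition.norm_xf_sub_le (h : IsTransition P N s s') {D : ℝ} (hD0 : 0 ≤ D)
    (hD : ∀ i, i + 1 < N → ‖v' i - s'.v (i + 1)‖ ≤ D) {i : ℕ} (hi : i < N) :
    ‖xf (P.outerPred s'.z s'.w v' i) - xf (P.outerPred s.z s.w s'.v (i + 1))‖
      ≤ D * ∑ j ∈ Finset.range N, ‖P.Af ^ j * P.Bf‖ := by
  refine norm_le_of_recursion_single P.Af P.Bf
    (fun i => xf (P.outerPred s'.z s'.w v' i) - xf (P.outerPred s.z s.w s'.v (i + 1)))
    (fun i => v' i - s'.v (i + 1)) hi.le hD0 ?_ (fun j _ => ?_) (fun j hj => hD j (by omega))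
  · simp only [Plant.outerPred, h.z_eq, xf_outerNext, sub_self]
  · rw [Plant.outerPred, xf_outerNext, Plant.outerPred, xf_outerNext]
    simp only [map_sub]
    abel

theorem innerTraj_add_xf_succ (z : AugVec n₁ n₂) (xt : Vec n₂) (w v : ℕ → Vec q) (u : ℕ → Vec p)
    (i : ℕ) : innerTraj P z xt w v u (i + 1) + xf (P.outerPred z w v (i + 1))
      = Matrix.toEuclideanLin P.A₂ (innerTraj P z xt w v u i + xf (P.outerPred z w v i))
        + Matrix.toEuclideanLin P.B₂ (u i) := by
  rw [innerTraj_succ, Plant.outerPred, xf_outerNext, innerNext_add]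

/-- The deviations of x₂ and x_f are estimated separately, each driven by a single input, and
subtracted. -/
theorem IsTransition.norm_innerTraj_sub_le (h : IsTransition P N s s') {D Du : ℝ} (hD0 : 0 ≤ D)
    (hDu0 : 0 ≤ Du) (hD : ∀ i, i + 1 < N → ‖v' i - s'.v (i + 1)‖ ≤ D)
    (hDu : ∀ i, i + 1 < N → ‖u' i - s'.u (i + 1)‖ ≤ Du) {i : ℕ} (hi : i < N) :
    ‖innerTraj P s'.z s'.xt s'.w v' u' i - innerTraj P s.z s.xt s.w s'.v s'.u (i + 1)‖
      ≤ Du * ∑ j ∈ Finset.range N, ‖P.A₂ ^ j * P.B₂‖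
        + D * ∑ j ∈ Finset.range N, ‖P.Af ^ j * P.Bf‖ := by
  have hxf := h.norm_xf_sub_le hD0 hD hi
  have hsum := norm_le_of_recursion_single P.A₂ P.B₂
    (fun i => (innerTraj P s'.z s'.xt s'.w v' u' i + xf (P.outerPred s'.z s'.w v' i))
      - (innerTraj P s.z s.xt s.w s'.v s'.u (i + 1) + xf (P.outerPred s.z s.w s'.v (i + 1))))
    (fun i => u' i - s'.u (i + 1)) (n := i) hi.le hDu0 ?_ (fun j _ => ?_)
    (fun j hj => hDu j (by omega))
  · rw [add_sub_add_comm] at hsum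
    calc _ = ‖_ + _ - _‖ := by rw [add_sub_cancel_right]
      _ ≤ _ := (norm_sub_le _ _).trans (add_le_add hsum hxf)
  · simp only [innerTraj_succ, Plant.outerPred, innerTraj_zero, h.z_eq, h.xt_eq, xf_outerNext,
      sub_self]
  · simp only [innerTraj_add_xf_succ _ _ _ _ _ j, innerTraj_add_xf_succ _ _ _ _ _ (j + 1), map_sub]
    abel

/-- The design inequalities are homogeneous in the rate bounds, so a common factor c passes to ε.
The value c = 1 serves feasibility, c = βⁿ convergence. -/
theorem IsTransition.norm_out_sub_le (hR : IsRateDesign P T R Δ₁ Δ₂ εf)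
    (h : IsTransition P R.N s s') {c : ℝ} (hc : 0 ≤ c)
    (hD : ∀ i, i + 1 < R.N → ‖v' i - s'.v (i + 1)‖ ≤ R.δv * c)
    (hDu : ∀ i, i + 1 < R.N → ‖u' i - s'.u (i + 1)‖ ≤ R.δu * c) {i : ℕ} (hi : i < R.N) :
    ‖P.out (innerTraj P s'.z s'.xt s'.w v' u' i) - s'.w i‖ ≤ R.ε * c := by
  have hv0 : 0 ≤ R.δv * c := mul_nonneg hR.δv_pos.le hc
  have hu0 : 0 ≤ R.δu * c := mul_nonneg hR.δu_pos.le hc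
  rw [h.w_eq i hi, ← out_sub]
  calc _ ≤ ‖P.C‖ * _ := norm_toEuclideanLin_le _ _
    _ ≤ ‖P.C‖ * _ := mul_le_mul_of_nonneg_left
        (h.norm_innerTraj_sub_le hv0 hu0 hD hDu hi) (norm_nonneg _)
    _ = c * (R.δu * (‖P.C‖ * ∑ j ∈ Finset.range R.N, ‖P.A₂ ^ j * P.B₂‖)
          + ‖P.C‖ * (R.δv * ∑ j ∈ Finset.range R.N, ‖P.Af ^ j * P.Bf‖)) := by ring
    _ ≤ c * ((R.ε - ‖P.C‖ * εf) + ‖P.C‖ * εf) :=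
        mul_le_mul_of_nonneg_left (add_le_add hR.δu_le
          (mul_le_mul_of_nonneg_left hR.δv_le (norm_nonneg _))) hc
    _ = R.ε * c := by ring

/-- The shifted trajectories, continued by the terminal laws, remain feasible. -/
theorem IsTransition.outerFeasible_nonempty (hT : T.IsContractive P)
    (hR : IsRateDesign P T R Δ₁ Δ₂ εf) (h : IsTransition P R.N s s')
    (hout : OuterConstraints P T R.N s.z s.w s'.v)
    (hin : InnerConstraints P T R.N s.z s.xt s.w s'.v s'.u)
    (htol : InitialTolerance P R s.z s.xt s.w s'.v s'.u) (k : ℕ) :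
    (outerFeasible P T R S (k + 1) s').Nonempty := by
  obtain ⟨n, hn⟩ := Nat.exists_eq_succ_of_ne_zero hR.N_pos.ne'
  rw [Nat.succ_eq_add_one] at hn
  set v₀ : ℕ → Vec q := fun i => s'.v (i + 1)
  -- Entry `n` of the input does not affect the prediction at `n`, so the terminal inputs can be
  -- defined from predictions with the unmodified shifts: first a, then v', b and u'.
  set a := P.outerPred s'.z s'.w v₀ n
  set v' : ℕ → Vec q := Function.update v₀ n (T.vTerm a)
  set u₀ : ℕ → Vec p := fun i => s'.u (i + 1)
  set b := innerTraj P s'.z s'.xt s'.w v' u₀ n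
  set u' : ℕ → Vec p := Function.update u₀ n (T.uTerm a b)
  have hvn : v' n = T.vTerm a := Function.update_self ..
  have hun : u' n = T.uTerm a b := Function.update_self ..
  have hvi : ∀ i, i < n → v' i = s'.v (i + 1) := fun i hi => Function.update_of_ne hi.ne _ _
  have hui : ∀ i, i < n → u' i = s'.u (i + 1) := fun i hi => Function.update_of_ne hi.ne _ _
  have hv0 : ∀ i, i + 1 < R.N → ‖v' i - s'.v (i + 1)‖ ≤ 0 := fun i hi => by
    rw [hvi i (by omega), sub_self, norm_zero]
  have hu0 : ∀ i, i + 1 < R.N → ‖u' i - s'.u (i + 1)‖ ≤ 0 := fun i hi => by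
    rw [hui i (by omega), sub_self, norm_zero]
  have hnN : n < R.N := by omega
  have ha' : P.outerPred s'.z s'.w v' n = a := outerPred_congr _ _ fun i hi => hvi i hi
  have hb' : innerTraj P s'.z s'.xt s'.w v' u' n = b := innerTraj_congr _ _ _ _ fun i hi => hui i hi
  -- The old endpoint lies in λ₁G₁; the stale ṽ moves it by at most ε times the gain sum, hence by
  -- at most Δ₁.
  have haG : a ∈ T.G₁ := by
    have := h.norm_outerPred_sub_le hR.ε_pos.le le_rfl htol hv0 hnN
    rw [ha', zero_mul, add_zero, ← hn] at this
    exact hR.margin₁ _ hout.2 _ (this.trans hR.ε_le)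
  -- The shifted inputs reproduce x̃ exactly: a wrong ṽ never enters x_f.
  have hbeq : b = innerTraj P s.z s.xt s.w s'.v s'.u R.N := by
    have := h.norm_innerTraj_sub_le le_rfl le_rfl hv0 hu0 hnN
    rw [hb', zero_mul, zero_mul, add_zero, ← hn] at this
    exact sub_eq_zero.1 (norm_le_zero_iff.1 this)
  have hbG : b ∈ T.G₂ := hT.lam₂_smul_subset (hbeq ▸ hin.1)
  -- The last stored ṽ is exactly the output of b, so the outer prediction takes a true terminal
  -- step from (a, b).
  have hwn : s'.w n = P.out b := by rw [h.w_eq n hnN, hbeq, hn]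
  refine ⟨v', ⟨?_, ?_⟩, fun _ i hi => (hv0 i hi).trans ?_, u', ⟨?_, fun i hi => ?_⟩, ?_,
    fun _ i hi => (hu0 i hi).trans ?_⟩
  · rwa [hn, Nat.add_sub_cancel, ha']
  · rw [hn, Plant.outerPred, ha', hvn, hwn]
    exact hT.outer _ haG _ hbG
  · exact mul_nonneg hR.δv_pos.le (pow_nonneg hR.β_pos.le _)
  · rw [hn, innerTraj_succ, hb', ha', hvn, hun]
    exact hT.inner _ haG _ hbG
  · rcases Nat.lt_or_ge i n with hlt | hge
    · rw [hui i hlt]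
      exact hin.2 _ (by omega)
    · rw [show i = n by omega, hun]
      exact hT.input _ haG _ hbG
  · exact fun h0 => absurd h0 k.succ_ne_zero
  · exact mul_nonneg hR.δu_pos.le (pow_nonneg hR.β_pos.le _)

end Prediction

/-! ### Closed loop: recursive feasibility and finite-time entry into terminal mode. -/

section ClosedLoop

/-- A step of the closed loop at time `k` in which model predictive control is active. -/
structure MPCStep (P : Plant n₁ n₂ q p) (T : Terminal n₁ n₂ q p) (R : Rates)
    (S : Tuning n₁ n₂ q p) (k : ℕ) (s s' : LoopState n₁ n₂ q p) : Prop
    extends IsTransition P R.N s s' where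
  v_mem : s'.v ∈ outerFeasible P T R S k s
  u_mem : s'.u ∈ innerFeasible P T R S k s s'.v

theorem mpcStep_of_not_inTerminal {k : ℕ} {s s' : LoopState n₁ n₂ q p} (hs : ¬ InTerminal T s)
    (h : s' ∈ successors P T R S k s) : MPCStep P T R S k s s' := by
  rcases h with h | h
  · exact absurd h.1 hs
  · exact ⟨⟨h.2.2.2.1, h.2.2.2.2.1, h.2.2.2.2.2⟩, h.2.1.1, h.2.2.1.1⟩

theorem exists_isChoice {α : Type*} (k : ℕ) {F : Set α} (hF : F.Nonempty) (J : α → ℝ) :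
    ∃ a, IsChoice k F J a := by
  by_cases hmin : ∃ b ∈ F, IsMinOn J F b
  · obtain ⟨b, hb, hJ⟩ := hmin
    exact ⟨b, hb, fun _ _ => hJ⟩
  · obtain ⟨a, ha⟩ := hF
    exact ⟨a, ha, fun _ h => absurd h hmin⟩

theorem successors_nonempty {k : ℕ} {s : LoopState n₁ n₂ q p}
    (h : (outerFeasible P T R S k s).Nonempty) : (successors P T R S k s).Nonempty := by
  by_cases hs : InTerminal T s
  · exact successors_nonempty_of_inTerminal hs
  · obtain ⟨v, hv⟩ := exists_isChoice k h (outerCost P R S s)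
    obtain ⟨u, hu⟩ := exists_isChoice k hv.1.2.2 (innerCost P R S s v)
    exact ⟨⟨P.outerNext s.z (P.out s.xt) (v 0), P.innerNext s.xt (xf s.z) (v 0) (u 0),
      fun i => P.out (innerTraj P s.z s.xt s.w v u (i + 1)), v, u⟩,
      Or.inr ⟨hs, hv, hu, rfl, rfl, fun _ _ => rfl⟩⟩

theorem MPCStep.rate_le (hR : IsRateDesign P T R Δ₁ Δ₂ εf) {k n : ℕ}
    {s s' : LoopState n₁ n₂ q p} (h : MPCStep P T R S (k + 1) s s') (hk : n ≤ k + 1)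
    (hN₁ : n ≤ S.N₁) (hN₂ : n ≤ S.N₂) :
    (∀ i, i + 1 < R.N → ‖s'.v i - s.v (i + 1)‖ ≤ R.δv * R.β ^ n) ∧
      ∀ i, i + 1 < R.N → ‖s'.u i - s.u (i + 1)‖ ≤ R.δu * R.β ^ n :=
  ⟨fun i hi => (h.v_mem.2.1 k.succ_ne_zero i hi).trans (mul_le_mul_of_nonneg_left
      (pow_le_pow_of_le_one hR.β_pos.le hR.β_lt.le (le_min hk hN₁)) hR.δv_pos.le),
    fun i hi => (h.u_mem.2.2 k.succ_ne_zero i hi).trans (mul_le_mul_of_nonneg_left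
      (pow_le_pow_of_le_one hR.β_pos.le hR.β_lt.le (le_min hk hN₂)) hR.δu_pos.le)⟩

theorem MPCStep.tolerance (hR : IsRateDesign P T R Δ₁ Δ₂ εf) {k n : ℕ}
    {s s' s'' : LoopState n₁ n₂ q p} (h : MPCStep P T R S k s s')
    (h' : MPCStep P T R S (k + 1) s' s'') (hk : n ≤ k + 1) (hN₁ : n ≤ S.N₁) (hN₂ : n ≤ S.N₂)
    {i : ℕ} (hi : i < R.N) :
    ‖P.out (innerTraj P s'.z s'.xt s'.w s''.v s''.u i) - s'.w i‖ ≤ R.ε * R.β ^ n :=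
  have hr := h'.rate_le hR hk hN₁ hN₂
  h.toIsTransition.norm_out_sub_le hR (pow_nonneg hR.β_pos.le n) hr.1 hr.2 hi

/-- The tolerance is imposed only at time 0; later it follows from the rate constraints, whose decay
factor is at most 1. Invariance of the terminal sets ensures that predictive control was active one
step earlier too. -/
theorem initialTolerance_of_run (hT : T.IsContractive P) (hR : IsRateDesign P T R Δ₁ Δ₂ εf)
    {σ : ℕ → LoopState n₁ n₂ q p} {k : ℕ}
    (hσ : ∀ j ≤ k, σ (j + 1) ∈ successors P T R S j (σ j)) (hk : ¬ InTerminal T (σ k)) :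
    InitialTolerance P R (σ k).z (σ k).xt (σ k).w (σ (k + 1)).v (σ (k + 1)).u := by
  have hstep := mpcStep_of_not_inTerminal hk (hσ k le_rfl)
  cases k with
  | zero => exact hstep.u_mem.2.1 rfl
  | succ k =>
    have hk' : ¬ InTerminal T (σ k) := fun h => hk (inTerminal_succ hT h (hσ k k.le_succ))
    intro i hi
    simpa using (mpcStep_of_not_inTerminal hk' (hσ k k.le_succ)).tolerance hR hstep
      (Nat.zero_le _) (Nat.zero_le _) (Nat.zero_le _) hi

/-- Recursive feasibility. -/
theorem successors_nonempty_of_isRunUpTo (hT : T.IsContractive P)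
    (hR : IsRateDesign P T R Δ₁ Δ₂ εf) {x : AugVec n₁ n₂ × Vec n₂} {M : ℕ}
    {σ : ℕ → LoopState n₁ n₂ q p} (h : IsRunUpTo P T R S x M σ) :
    (successors P T R S M (σ M)).Nonempty := by
  cases M with
  | zero => exact h.2.1
  | succ k =>
    have hσ : ∀ j ≤ k, σ (j + 1) ∈ successors P T R S j (σ j) :=
      fun j hj => h.2.2 j (Nat.lt_succ_of_le hj)
    by_cases hk : InTerminal T (σ k)
    · exact successors_nonempty_of_inTerminal (inTerminal_succ hT hk (hσ k le_rfl))
    · have hstep := mpcStep_of_not_inTerminal hk (hσ k le_rfl)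
      exact successors_nonempty (hstep.toIsTransition.outerFeasible_nonempty hT hR
        hstep.v_mem.1 hstep.u_mem.1 (initialTolerance_of_run hT hR hσ hk) k)

/-- If `a k i` is the value at time `k + i` predicted at time `k`, and consecutive predictions
differ by at most `D`, then the value at time `k + N` differs by at most `N D` from its prediction
at time `k`. -/
theorem norm_sub_le_of_predictions {E : Type*} [NormedAddCommGroup E] (a : ℕ → ℕ → E) {D : ℝ}
    {k N : ℕ} (h : ∀ j ≥ k, ∀ i < N, ‖a (j + 1) i - a j (i + 1)‖ ≤ D) :
    ‖a (k + N) 0 - a k N‖ ≤ N * D := by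
  -- Telescoping at the fixed instant k + N, which lies N - j steps ahead of time k + j.
  have key : ∀ j ≤ N, ‖a (k + j) (N - j) - a k N‖ ≤ j * D := by
    intro j hj
    induction j with
    | zero => simp
    | succ j ih =>
      have h1 := h (k + j) (Nat.le_add_right k j) (N - (j + 1)) (by omega)
      rw [show N - (j + 1) + 1 = N - j by omega] at h1
      have h2 := norm_sub_le_norm_sub_add_norm_sub (a (k + (j + 1)) (N - (j + 1)))
        (a (k + j) (N - j)) (a k N)
      rw [← add_assoc] at h2 ⊢
      push_cast
      linarith [ih (by omega)]
  simpa using key N le_rfl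

/-- Drift of the outer predictions per step and unit of the decay factor. -/
noncomputable def outerDrift (P : Plant n₁ n₂ q p) (R : Rates) : ℝ :=
  R.ε * ∑ j ∈ Finset.range R.N, ‖P.A₁aug ^ j * P.B₁aug‖
    + R.δv * ∑ j ∈ Finset.range R.N, ‖P.A₁aug ^ j * P.Bfaug‖

/-- Drift of the inner predictions per step and unit of the decay factor. -/
noncomputable def innerDrift (P : Plant n₁ n₂ q p) (R : Rates) : ℝ :=
  R.δu * ∑ j ∈ Finset.range R.N, ‖P.A₂ ^ j * P.B₂‖
    + R.δv * ∑ j ∈ Finset.range R.N, ‖P.Af ^ j * P.Bf‖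

theorem exists_inTerminal (hR : IsRateDesign P T R Δ₁ Δ₂ εf) {δ₁ δ₂ : ℝ}
    (hδ₁ : ∀ y ∈ T.lam₁ • T.G₁, ∀ z, ‖z - y‖ ≤ δ₁ → z ∈ T.G₁)
    (hδ₂ : ∀ y ∈ T.lam₂ • T.G₂, ∀ z, ‖z - y‖ ≤ δ₂ → z ∈ T.G₂) {n : ℕ}
    (hn₁ : R.N * (outerDrift P R * R.β ^ n) ≤ δ₁) (hn₂ : R.N * (innerDrift P R * R.β ^ n) ≤ δ₂)
    (hN₁ : n ≤ S.N₁) (hN₂ : n ≤ S.N₂) {σ : ℕ → LoopState n₁ n₂ q p}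
    (hσ : ∀ k, σ (k + 1) ∈ successors P T R S k (σ k)) : ∃ k, InTerminal T (σ k) := by
  by_contra! hnot
  have hstep : ∀ k, MPCStep P T R S k (σ k) (σ (k + 1)) :=
    fun k => mpcStep_of_not_inTerminal (hnot k) (hσ k)
  have hβ : 0 ≤ R.β ^ n := pow_nonneg hR.β_pos.le n
  have hv0 : 0 ≤ R.δv * R.β ^ n := mul_nonneg hR.δv_pos.le hβ
  have hu0 : 0 ≤ R.δu * R.β ^ n := mul_nonneg hR.δu_pos.le hβ
  -- Starting at n + 1 gives every j a predecessor step, which is needed to bound the mismatch of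
  -- the stored ṽ by ε βⁿ.
  have hz := norm_sub_le_of_predictions
    (fun k i => P.outerPred (σ k).z (σ k).w (σ (k + 1)).v i) (D := outerDrift P R * R.β ^ n)
    (k := n + 1) (N := R.N) fun j hj i hi => by
      obtain ⟨l, rfl⟩ : ∃ l, j = l + 1 := ⟨j - 1, by omega⟩
      have hr := (hstep (l + 1 + 1)).rate_le hR (by omega) hN₁ hN₂
      refine ((hstep (l + 1)).toIsTransition.norm_outerPred_sub_le (mul_nonneg hR.ε_pos.le hβ) hv0
        (fun i hi => (hstep l).tolerance hR (hstep (l + 1)) (by omega) hN₁ hN₂ hi)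
        hr.1 hi).trans_eq ?_
      rw [outerDrift]
      ring
  have hx := norm_sub_le_of_predictions
    (fun k i => innerTraj P (σ k).z (σ k).xt (σ k).w (σ (k + 1)).v (σ (k + 1)).u i)
    (D := innerDrift P R * R.β ^ n) (k := n + 1) (N := R.N) fun j hj i hi => by
      have hr := (hstep (j + 1)).rate_le hR (by omega) hN₁ hN₂
      refine ((hstep j).toIsTransition.norm_innerTraj_sub_le hv0 hu0 hr.1 hr.2 hi).trans_eq ?_
      rw [innerDrift]
      ring
  exact hnot (n + 1 + R.N) ⟨hδ₁ _ (hstep (n + 1)).v_mem.1.2 _ (hz.trans hn₁),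
    hδ₂ _ (hstep (n + 1)).u_mem.1.1 _ (hx.trans hn₂)⟩

/-- A start in terminal mode says nothing about the guess; there the inclusion of the terminal sets
in X is needed. -/
theorem mem_feasibleSet_of_successors_nonempty (hT : T.IsContractive P)
    (hR : IsRateDesign P T R Δ₁ Δ₂ εf) {s : LoopState n₁ n₂ q p}
    (h : (successors P T R S 0 s).Nonempty) : s.phys ∈ feasibleSet P T R := by
  by_cases hs : InTerminal T s
  · exact terminal_subset_feasibleSet hT hR hs
  · obtain ⟨s', hs'⟩ := h
    have hstep := mpcStep_of_not_inTerminal hs hs'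
    exact ⟨s.w, s'.v, s'.u, hstep.v_mem.1, hstep.u_mem.1, hstep.u_mem.2.1 rfl⟩

theorem exists_isRunUpTo_zero {x : AugVec n₁ n₂ × Vec n₂} (hx : x ∈ feasibleSet P T R) :
    ∃ σ, IsRunUpTo P T R S x 0 σ := by
  obtain ⟨w, v, u, hout, hin, htol⟩ := hx
  refine ⟨fun _ => ⟨x.1, x.2, w, 0, 0⟩, rfl, successors_nonempty ?_, by simp⟩
  exact ⟨v, hout, fun h => absurd rfl h, u, hin, fun _ => htol, fun h => absurd rfl h⟩

end ClosedLoop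

end HierMPC

/-! ### The main theorem. -/

open HierMPC Filter in
theorem mainTheorem1 {n₁ n₂ q p : ℕ} (P : HierMPC.Plant n₁ n₂ q p)
    (T : HierMPC.Terminal n₁ n₂ q p) (hT : T.IsContractive P)
    (R : HierMPC.Rates) (Δ₁ Δ₂ εf : ℝ) (hR : HierMPC.IsRateDesign P T R Δ₁ Δ₂ εf) :
    ∃ Nbar : ℕ, ∀ S : HierMPC.Tuning n₁ n₂ q p, Nbar ≤ S.N₁ → Nbar ≤ S.N₂ →
      HierMPC.IsAsymptoticallyStable P T R S ∧
        HierMPC.regionOfAttraction P T R S = HierMPC.feasibleSet P T R := by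
  -- Fresh margins, because Δ₁ and Δ₂ may be zero, whereas the choice of n needs positive ones.
  obtain ⟨δ₁, hδ₁, hm₁⟩ := exists_margin hT.convex₁ hT.nhds₁ hT.lam₁_nonneg hT.lam₁_lt
  obtain ⟨δ₂, hδ₂, hm₂⟩ := exists_margin hT.convex₂ hT.nhds₂ hT.lam₂_nonneg hT.lam₂_lt
  have hlim : ∀ d : ℝ, Tendsto (fun n => R.N * (d * R.β ^ n)) atTop (𝓝 0) := fun d => by
    simpa using ((tendsto_pow_atTop_nhds_zero_of_lt_one hR.β_pos.le hR.β_lt).const_mul d).const_mul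
      (R.N : ℝ)
  obtain ⟨n, hn₁, hn₂⟩ := (((hlim (outerDrift P R)).eventually_le_const hδ₁).and
    ((hlim (innerDrift P R)).eventually_le_const hδ₂)).exists
  refine ⟨n, fun S hN₁ hN₂ => ?_⟩
  have hreg : regionOfAttraction P T R S = feasibleSet P T R := by
    refine Set.Subset.antisymm ?_ fun x hx => ⟨exists_isRunUpTo_zero hx,
      fun M σ h => successors_nonempty_of_isRunUpTo hT hR h, fun σ hσ => ?_⟩
    · rintro _ ⟨⟨σ, rfl, h, -⟩, -⟩
      exact mem_feasibleSet_of_successors_nonempty hT hR h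
    · have hσ' : ∀ k, σ (k + 1) ∈ successors P T R S k (σ k) :=
        fun k => (hσ (k + 1)).2.2 k k.lt_succ_self
      obtain ⟨k, hk⟩ := exists_inTerminal hR hm₁ hm₂ hn₁ hn₂ hN₁ hN₂ hσ'
      exact tendsto_of_inTerminal hT hσ' hk
  refine ⟨⟨fun η hη => lyapunov_stable hT hη, ?_⟩, hreg⟩
  rw [hreg]
  exact mem_of_superset (prod_mem_nhds hT.nhds₁ hT.nhds₂) (terminal_subset_feasibleSet hT hR)
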